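/- For complex numbers $a,q$ with $|q|<1$ put $(a;q)_\infty=\prod_{k=0}^{\infty}(1-aq^k)$. Let $q,z\in\mathbb{C}$ with $0<|q|<1$ and $z\neq 0$, and suppose that $zq^k\neq 1$ and $z^{-1}q^k\neq 1$ for every integer $k\ge 1$ (so that no denominator below vanishes). Define $$\mathrm{ST}(z,q)=\sum_{n=1}^{\infty}\frac{q^n\,(q^{2n};q)_\infty}{(zq^n;q)_\infty\,(z^{-1}q^n;q)_\infty}.$$ Then this series and the bilateral series below converge absolutely, and $$\mathrm{ST}(z,q)=\frac{1}{(q;q)_\infty}\sum_{n=-\infty}^{\infty}\frac{q^{6n^2+4n+1}\,(1-q^{6n+2})}{(1-zq^{3n+1})(1-z^{-1}q^{3n+1})}.$$ -/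

import Mathlib

/-- The infinite `q`-Pochhammer symbol `(a; q)_∞ = ∏_{k ≥ 0} (1 - a q ^ k)`. -/
noncomputable def qPochhammerInf (a q : ℂ) : ℂ :=
  ∏' k : ℕ, (1 - a * q ^ k)

/-- The infinite product defining `(a; q)_∞` converges whenever `|q| < 1`. -/
theorem multipliable_qPochhammerInf (a : ℂ) {q : ℂ} (hq : ‖q‖ < 1) :
    Multipliable (fun k : ℕ => 1 - a * q ^ k) := by
  have h : Summable (fun k : ℕ => ‖-(a * q ^ k)‖) := by
    simpa [norm_mul, norm_pow] using
      (summable_geometric_of_lt_one (norm_nonneg q) hq).mul_left ‖a‖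
  simpa [sub_eq_add_neg] using multipliable_one_add_of_summable h

/-- The `n`-th summand `q ^ n (q ^ (2n); q)_∞ / (z q ^ n, z⁻¹ q ^ n; q)_∞` of `ST(z, q)`. -/
noncomputable def STTerm (z q : ℂ) (n : ℕ) : ℂ :=
  q ^ n * qPochhammerInf (q ^ (2 * n)) q /
    (qPochhammerInf (z * q ^ n) q * qPochhammerInf (z⁻¹ * q ^ n) q)

/-- `ST(z, q) = ∑_{n ≥ 1} q ^ n (q ^ (2n); q)_∞ / (z q ^ n, z⁻¹ q ^ n; q)_∞`. -/
noncomputable def partitionPairST (z q : ℂ) : ℂ :=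
  ∑' n : ℕ, STTerm z q (n + 1)

/-- The `n`-th summand of the bilateral series for `ST(z, q)`, where `n` is any integer. -/
noncomputable def STBilateralTerm (z q : ℂ) (n : ℤ) : ℂ :=
  q ^ (6 * n ^ 2 + 4 * n + 1) * (1 - q ^ (6 * n + 2)) /
    ((1 - z * q ^ (3 * n + 1)) * (1 - z⁻¹ * q ^ (3 * n + 1)))

/-!
The identity is an instance of Bailey's lemma with parameters `a = 1`, `ρ₁ = z`, `ρ₂ = z⁻¹`.

Since `(q^(2n); q)_∞ = (q; q)_∞ / (q; q)_{2n-1}`, the series `ST(z, q)` is a sum against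
`β_n = 1 / (q; q)_{2n-1}`. This `β_n` expands as
`∑_r α_r / ((q; q)_{n+r} (q; q)_{n-r})`, summed over all integers `r` for `n ≥ 1`, where `α_r` is
`q ^ ((2r-1)(r-1)/3)` times the nonprincipal character modulo `3` (`hasSum_baileyWeight`). The
expansion is a finite theta identity for the `q`-binomial coefficients of row `2n`. It holds, up to
sign, in every row, and the `q`-Pascal rule reduces it to two companions: a finite pentagonal number
identity and a shifted version of it (`qBinomialSum_pentagonalWeight`,
`qBinomialSum_shiftedWeight`). In each of these, one of the two sums produced by the `q`-Pascal rule
has a weight that is odd under reflection of the row and vanishes.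

After interchanging the summations, the inner sum over `n` of
`q^n / ((zq^n, z⁻¹q^n; q)_∞ (q; q)_{n+r} (q; q)_{n-r})` telescopes (`conjugate_summand_eq_sub`), with
value `q^r / ((1 - zq^r)(1 - z⁻¹q^r) (q; q)_∞^2)` (`hasSum_conjugate`). This value is even in `r` and
`α_r` vanishes at the multiples of `3`, so grouping `r = 3n + 1` with `r = -(3n + 1)` leaves the
bilateral series (`baileyWeight_mul_add_neg`). Absolute convergence of the double series
(`summable_double`) gives that of both single series.
-/

open Finset Filter Topology

/-! ### Reciprocal `q`-factorials -/

/-- The reciprocal `q`-factorial `1 / (q; q)_k`, extended by `0` to negative integers `k`. -/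
noncomputable def recipQFactorial (q : ℂ) : ℤ → ℂ
  | .ofNat n => (∏ i ∈ range n, (1 - q * q ^ i))⁻¹
  | .negSucc _ => 0

theorem recipQFactorial_natCast (q : ℂ) (n : ℕ) :
    recipQFactorial q n = (∏ i ∈ range n, (1 - q * q ^ i))⁻¹ := rfl

theorem recipQFactorial_zero (q : ℂ) : recipQFactorial q 0 = 1 := by
  simpa using recipQFactorial_natCast q 0

theorem recipQFactorial_of_neg (q : ℂ) {k : ℤ} (hk : k < 0) : recipQFactorial q k = 0 := by
  cases k with
  | ofNat n => exact absurd hk (by simp)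
  | negSucc n => rfl

theorem one_sub_pow_ne_zero {q : ℂ} (hq : ‖q‖ < 1) {n : ℕ} (hn : n ≠ 0) : 1 - q ^ n ≠ 0 := by
  intro h
  have h1 : ‖q ^ n‖ = 1 := by rw [← sub_eq_zero.mp h, norm_one]
  rw [norm_pow] at h1
  exact (pow_lt_one₀ (norm_nonneg q) hq hn).ne h1

/-- The recurrence holds for all integers `k`, since at `k = 0` both sides vanish. -/
theorem one_sub_mul_recipQFactorial {q : ℂ} (hq : ‖q‖ < 1) (k : ℤ) :
    (1 - q ^ k) * recipQFactorial q k = recipQFactorial q (k - 1) := by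
  rcases lt_trichotomy k 0 with hk | rfl | hk
  · rw [recipQFactorial_of_neg q hk, recipQFactorial_of_neg q (by omega), mul_zero]
  · rw [recipQFactorial_of_neg q (k := 0 - 1) (by omega)]
    simp
  · obtain ⟨n, rfl⟩ : ∃ n : ℕ, k = (n + 1 : ℕ) := ⟨k.toNat - 1, by omega⟩
    have h : ((n + 1 : ℕ) : ℤ) - 1 = n := by push_cast; ring
    rw [h, recipQFactorial_natCast, recipQFactorial_natCast, prod_range_succ, zpow_natCast,
      ← pow_succ', mul_inv]
    have := one_sub_pow_ne_zero hq n.succ_ne_zero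
    field_simp

theorem one_sub_mul_recipQFactorial_succ {q : ℂ} (hq : ‖q‖ < 1) (n : ℕ) :
    (1 - q ^ (n + 1)) * recipQFactorial q ((n + 1 : ℕ) : ℤ) = recipQFactorial q n := by
  have := one_sub_mul_recipQFactorial hq ((n + 1 : ℕ) : ℤ)
  rw [zpow_natCast] at this
  rw [this]
  push_cast
  congr 1
  ring

/-! ### Weighted sums of `q`-binomial coefficients -/

/-- The sum `∑_{a + b = N} W (a - b) / ((q; q)_a (q; q)_b)`, which is `1 / (q; q)_N` times the
sum of the `q`-binomial coefficients `[N, a]` with weights `W (a - b)`. -/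
noncomputable def qBinomialSum (q : ℂ) (W : ℤ → ℂ) (N : ℕ) : ℂ :=
  ∑ x ∈ antidiagonal N, W (x.1 - x.2) * (recipQFactorial q x.1 * recipQFactorial q x.2)

theorem qBinomialSum_zero (q : ℂ) (W : ℤ → ℂ) : qBinomialSum q W 0 = W 0 := by
  simp [qBinomialSum, recipQFactorial_zero]

theorem qBinomialSum_neg (q : ℂ) (W : ℤ → ℂ) (N : ℕ) :
    qBinomialSum q (fun s => W (-s)) N = qBinomialSum q W N := by
  unfold qBinomialSum
  rw [← Finset.Nat.sum_antidiagonal_swap]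
  refine sum_congr rfl fun x _ => ?_
  simp only [Prod.fst_swap, Prod.snd_swap, neg_sub]
  ring

theorem qBinomialSum_const_mul (q c : ℂ) (W : ℤ → ℂ) (N : ℕ) :
    qBinomialSum q (fun s => c * W s) N = c * qBinomialSum q W N := by
  unfold qBinomialSum
  rw [mul_sum]
  exact sum_congr rfl fun x _ => by ring

/-- Terms with `W (-s) = -W s` cancel in pairs. -/
theorem qBinomialSum_of_odd (q : ℂ) {W : ℤ → ℂ} (hW : ∀ s, W (-s) = -W s) (N : ℕ) :
    qBinomialSum q W N = 0 := by
  have h := qBinomialSum_neg q W N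
  have h' : qBinomialSum q (fun s => W (-s)) N = -qBinomialSum q W N := by
    simpa [hW] using qBinomialSum_const_mul q (-1) W N
  rw [h'] at h
  exact self_eq_neg.mp h.symm

/-- The `q`-Pascal rule, summed over a row. The sixth root `p` of `q` makes the factor
`q ^ a` with `a + b = N`, `a - b = s` an integral power `p ^ (3 (N + s))`. -/
theorem qBinomialSum_succ {p q : ℂ} (hp : p ^ 6 = q) (hq : ‖q‖ < 1) (W : ℤ → ℂ) (N : ℕ) :
    (1 - q ^ (N + 1)) * qBinomialSum q W (N + 1) =
      qBinomialSum q (fun s => W (s + 1)) N +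
        qBinomialSum q (fun s => p ^ (3 * (N + s)) * W (s - 1)) N := by
  have key : (1 - q ^ (N + 1)) * qBinomialSum q W (N + 1) =
      ∑ x ∈ antidiagonal (N + 1), W (x.1 - x.2) *
          (((1 - q ^ x.1) * recipQFactorial q x.1) * recipQFactorial q x.2) +
      ∑ x ∈ antidiagonal (N + 1), W (x.1 - x.2) *
          (q ^ x.1 * (recipQFactorial q x.1 * ((1 - q ^ x.2) * recipQFactorial q x.2))) := by
    unfold qBinomialSum
    rw [mul_sum, ← sum_add_distrib]
    refine sum_congr rfl fun x hx => ?_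
    rw [← mem_antidiagonal.mp hx, pow_add]
    ring
  rw [key, Finset.Nat.sum_antidiagonal_succ, Finset.Nat.sum_antidiagonal_succ']
  simp only [one_sub_mul_recipQFactorial_succ hq, pow_zero, sub_self, zero_mul, mul_zero,
    zero_add]
  unfold qBinomialSum
  congr 1
  · refine sum_congr rfl fun x _ => ?_
    congr 2
    push_cast
    ring
  · refine sum_congr rfl fun x hx => ?_
    have hN : ((N : ℤ)) = x.1 + x.2 := by exact_mod_cast (mem_antidiagonal.mp hx).symm
    have h6 : p ^ (3 * ((N : ℤ) + (x.1 - x.2))) = q ^ x.1 := by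
      rw [hN, ← hp, ← pow_mul, ← zpow_natCast p (6 * x.1)]
      congr 1
      push_cast
      ring
    simp only [h6]
    have hs : ((x.1 : ℤ) - (x.2 + 1 : ℕ)) = x.1 - x.2 - 1 := by push_cast; ring
    rw [hs]
    ring

/-! ### Three finite theta identities modulo 3 -/

/-- The nonprincipal character modulo `3`, with values in `ℂ`. -/
noncomputable def charThree (s : ℤ) : ℂ :=
  if s % 3 = 1 then 1 else if s % 3 = 2 then -1 else 0

theorem charThree_neg (s : ℤ) : charThree (-s) = -charThree s := by
  unfold charThree
  rcases (by omega : s % 3 = 0 ∨ s % 3 = 1 ∨ s % 3 = 2) with h | h | h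
  · simp [h, (by omega : (-s) % 3 = 0)]
  · simp [h, (by omega : (-s) % 3 = 2)]
  · simp [h, (by omega : (-s) % 3 = 1)]

theorem charThree_add_three (s : ℤ) : charThree (s + 3) = charThree s := by
  simp [charThree]

theorem norm_charThree_le (s : ℤ) : ‖charThree s‖ ≤ 1 := by
  unfold charThree
  split_ifs <;> simp

/-- The weight of the pentagonal sum, where `p` is a sixth root of `q`: it is `q ^ (s (s + 1) / 6)`
with sign `1`, `0`, `-1` for `s ≡ 0, 1, 2` modulo `3`. -/
noncomputable def pentagonalWeight (p : ℂ) (s : ℤ) : ℂ := -charThree (s - 1) * p ^ (s ^ 2 + s)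

/-- The weight `q ^ (s (s - 2) / 6)` with the signs of `pentagonalWeight`. -/
noncomputable def shiftedWeight (p : ℂ) (s : ℤ) : ℂ := -charThree (s - 1) * p ^ (s ^ 2 - 2 * s)

/-- The weight `q ^ ((s - 1) (s - 2) / 6)` with sign `0`, `-1`, `1` for `s ≡ 0, 1, 2` modulo `3`,
where `p` is a sixth root of `q`. At `s = 2r` it is the coefficient of
`1 / ((q; q)_{n+r} (q; q)_{n-r})` in the expansion of `1 / (q; q)_{2n-1}`. -/
noncomputable def baileyWeight (p : ℂ) (s : ℤ) : ℂ := -charThree s * p ^ ((s - 1) * (s - 2))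

variable {p q : ℂ}

theorem eq_mul_recipQFactorial_succ (hq : ‖q‖ < 1) {x c : ℂ} {N : ℕ}
    (h : (1 - q ^ (N + 1)) * x = c * recipQFactorial q N) :
    x = c * recipQFactorial q ((N + 1 : ℕ) : ℤ) := by
  rw [← one_sub_mul_recipQFactorial_succ hq] at h
  refine mul_left_cancel₀ (one_sub_pow_ne_zero hq (Nat.add_one_ne_zero N)) (h.trans (by ring))

theorem pentagonalWeight_neg_add_one (s : ℤ) :
    pentagonalWeight p (-(s + 1)) = -1 * pentagonalWeight p s := by
  unfold pentagonalWeight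
  rw [(by ring : -(s + 1) - 1 = -(s - 1 + 3)), charThree_neg, charThree_add_three,
    (by ring : (-(s + 1)) ^ 2 + -(s + 1) = s ^ 2 + s)]
  ring

theorem pentagonalWeight_neg (s : ℤ) :
    pentagonalWeight p (-s) = charThree (s + 1) * p ^ (s ^ 2 - s) := by
  unfold pentagonalWeight
  rw [(by ring : -s - 1 = -(s + 1)), charThree_neg, (by ring : (-s) ^ 2 + -s = s ^ 2 - s)]
  ring

/-- A finite form of Euler's pentagonal number theorem: one half of the `q`-Pascal rule gives a
weight that is odd in `s`, the other reproduces the sum with the opposite sign. -/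
theorem qBinomialSum_pentagonalWeight (hp : p ^ 6 = q) (hp0 : p ≠ 0) (hq : ‖q‖ < 1) (N : ℕ) :
    qBinomialSum q (pentagonalWeight p) N = (-1) ^ N * recipQFactorial q N := by
  induction N with
  | zero =>
    rw [qBinomialSum_zero]
    simp [pentagonalWeight, charThree, recipQFactorial_zero]
  | succ N ih =>
    apply eq_mul_recipQFactorial_succ hq
    rw [← qBinomialSum_neg, qBinomialSum_succ hp hq, qBinomialSum_of_odd q (N := N)
      (W := fun s : ℤ => p ^ (3 * (N + s)) * pentagonalWeight p (-(s - 1)))]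
    · simp only [pentagonalWeight_neg_add_one, qBinomialSum_const_mul, ih]
      ring
    · have h (s : ℤ) : p ^ (3 * (N + s)) * pentagonalWeight p (-(s - 1)) =
          charThree s * p ^ (3 * N + s ^ 2 + 2) := by
        rw [pentagonalWeight_neg, sub_add_cancel, mul_left_comm, ← zpow_add₀ hp0]
        congr 2
        ring
      intro s
      rw [h, h, charThree_neg, neg_sq]
      ring

/-- One half of the `q`-Pascal rule gives an odd weight, the other the pentagonal sum. -/
theorem qBinomialSum_shiftedWeight (hp : p ^ 6 = q) (hp0 : p ≠ 0) (hq : ‖q‖ < 1) (N : ℕ) :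
    qBinomialSum q (shiftedWeight p) N = (-1) ^ N * p ^ (3 * N) * recipQFactorial q N := by
  cases N with
  | zero =>
    rw [qBinomialSum_zero]
    simp [shiftedWeight, charThree, recipQFactorial_zero]
  | succ N =>
    apply eq_mul_recipQFactorial_succ hq
    have h (s : ℤ) : p ^ (3 * (N + s)) * shiftedWeight p (s - 1) =
        -p ^ (3 * (N + 1)) * pentagonalWeight p (-s) := by
      rw [pentagonalWeight_neg, shiftedWeight, ← charThree_add_three (s - 1 - 1),
        (by ring : s - 1 - 1 + 3 = s + 1), ← zpow_natCast p (3 * (N + 1)), neg_mul, neg_mul,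
        mul_neg, mul_left_comm, mul_left_comm (p ^ ((3 * (N + 1) : ℕ) : ℤ)), ← zpow_add₀ hp0,
        ← zpow_add₀ hp0]
      congr 3
      push_cast
      ring
    rw [qBinomialSum_succ hp hq, qBinomialSum_of_odd q (N := N)
      (W := fun s : ℤ => shiftedWeight p (s + 1))]
    · simp only [h, qBinomialSum_const_mul, qBinomialSum_neg,
        qBinomialSum_pentagonalWeight hp hp0 hq]
      ring
    · have h' (s : ℤ) : shiftedWeight p (s + 1) = -charThree s * p ^ (s ^ 2 - 1) := by
        rw [shiftedWeight, add_sub_cancel_right]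
        congr 2
        ring
      intro s
      rw [h', h', charThree_neg, neg_sq]
      ring

/-- The two halves of the `q`-Pascal rule give the pentagonal sum and the shifted sum, which
combine to a multiple of `1 - q ^ (N + 1)`. -/
theorem qBinomialSum_baileyWeight_succ (hp : p ^ 6 = q) (hp0 : p ≠ 0) (hq : ‖q‖ < 1) (N : ℕ) :
    qBinomialSum q (baileyWeight p) (N + 1) = (-1) ^ (N + 1) * recipQFactorial q N := by
  refine mul_left_cancel₀ (one_sub_pow_ne_zero hq (Nat.add_one_ne_zero N)) ?_
  have h (s : ℤ) : p ^ (3 * (N + s)) * baileyWeight p (s - 1) =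
      p ^ (3 * N + 6) * shiftedWeight p s := by
    rw [baileyWeight, shiftedWeight, ← zpow_natCast p (3 * N + 6), mul_left_comm,
      mul_left_comm (p ^ _), ← zpow_add₀ hp0, ← zpow_add₀ hp0]
    congr 2
    push_cast
    ring
  have h' (s : ℤ) : baileyWeight p (s + 1) = -1 * pentagonalWeight p (-s) := by
    rw [pentagonalWeight_neg, baileyWeight, (by ring : (s + 1 - 1) * (s + 1 - 2) = s ^ 2 - s)]
    ring
  rw [qBinomialSum_succ hp hq]
  simp only [h, h', qBinomialSum_const_mul, qBinomialSum_neg,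
    qBinomialSum_pentagonalWeight hp hp0 hq, qBinomialSum_shiftedWeight hp hp0 hq]
  rw [← hp]
  ring

/-- The Bailey pair relative to `a = 1` with `β_n = 1 / (q; q)_{2n-1}`, in bilateral form. -/
theorem hasSum_baileyWeight (hp : p ^ 6 = q) (hp0 : p ≠ 0) (hq : ‖q‖ < 1) {n : ℕ} (hn : n ≠ 0) :
    HasSum (fun r : ℤ =>
        baileyWeight p (2 * r) * (recipQFactorial q (n + r) * recipQFactorial q (n - r)))
      (recipQFactorial q (2 * n - 1 : ℤ)) := by
  have hinj : Function.Injective fun i : ℕ => (i : ℤ) - n := fun i j h => by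
    simpa using h
  rw [← hinj.hasSum_iff]
  · have hval : recipQFactorial q (2 * n - 1 : ℤ) = qBinomialSum q (baileyWeight p) (2 * n) := by
      obtain ⟨m, rfl⟩ := Nat.exists_eq_succ_of_ne_zero hn
      rw [(by omega : 2 * m.succ = 2 * m + 1 + 1), qBinomialSum_baileyWeight_succ hp hp0 hq,
        Even.neg_one_pow ⟨m + 1, by ring⟩, one_mul]
      congr 1
      push_cast
      ring
    rw [hval, qBinomialSum, Finset.Nat.sum_antidiagonal_eq_sum_range_succ_mk]
    have hsum : ∑ k ∈ range (2 * n).succ, baileyWeight p ((k : ℤ) - (2 * n - k : ℕ)) *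
          (recipQFactorial q k * recipQFactorial q (2 * n - k : ℕ)) =
        ∑ k ∈ range (2 * n).succ, ((fun r : ℤ => baileyWeight p (2 * r) *
          (recipQFactorial q (n + r) * recipQFactorial q (n - r))) ∘
            fun i : ℕ => (i : ℤ) - n) k := by
      refine sum_congr rfl fun k hk => ?_
      have hk' : k ≤ 2 * n := Nat.lt_succ_iff.mp (mem_range.mp hk)
      simp only [Function.comp_apply]
      push_cast [hk']
      congr 2
      · ring
      · congr 1; ring
      · congr 1; ring
    rw [hsum]
    refine hasSum_sum_of_ne_finset_zero fun k hk => ?_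
    have hk' : 2 * n < k := by simpa using hk
    simp only [Function.comp_apply]
    rw [recipQFactorial_of_neg q (k := (n : ℤ) - (k - n)) (by omega), mul_zero, mul_zero]
  · intro r hr
    rw [recipQFactorial_of_neg q (k := (n : ℤ) + r), zero_mul, mul_zero]
    by_contra hcon
    exact hr ⟨((n : ℤ) + r).toNat, by simp; omega⟩

/-! ### Infinite products -/

theorem tendsto_prod_qPochhammerInf (a : ℂ) (hq : ‖q‖ < 1) :
    Tendsto (fun n => ∏ i ∈ range n, (1 - a * q ^ i)) atTop (𝓝 (qPochhammerInf a q)) :=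
  (multipliable_qPochhammerInf a hq).tendsto_prod_tprod_nat

theorem prod_mul_qPochhammerInf (a : ℂ) (hq : ‖q‖ < 1) (n : ℕ) :
    (∏ i ∈ range n, (1 - a * q ^ i)) * qPochhammerInf (a * q ^ n) q = qPochhammerInf a q := by
  have h : (fun k : ℕ => 1 - a * q ^ n * q ^ k) = fun k : ℕ => 1 - a * q ^ (k + n) := by
    funext k
    ring
  have hm := multipliable_qPochhammerInf (a * q ^ n) hq
  unfold qPochhammerInf
  rw [h] at hm ⊢
  exact Multipliable.prod_mul_tprod_nat_mul' (f := fun k => 1 - a * q ^ k) hm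

theorem one_sub_mul_qPochhammerInf (a : ℂ) (hq : ‖q‖ < 1) :
    (1 - a) * qPochhammerInf (a * q) q = qPochhammerInf a q := by
  simpa using prod_mul_qPochhammerInf a hq 1

theorem qPochhammerInf_ne_zero {a : ℂ} (hq : ‖q‖ < 1) (h : ∀ k : ℕ, a * q ^ k ≠ 1) :
    qPochhammerInf a q ≠ 0 := by
  have hs : Summable (fun k : ℕ => ‖-(a * q ^ k)‖) := by
    simpa [norm_mul, norm_pow] using
      (summable_geometric_of_lt_one (norm_nonneg q) hq).mul_left ‖a‖
  have := tprod_one_add_ne_zero_of_summable (f := fun k : ℕ => -(a * q ^ k))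
    (fun k hk => h k (by linear_combination -hk)) hs
  simpa [qPochhammerInf, sub_eq_add_neg] using this

theorem qPochhammerInf_self_ne_zero (hq : ‖q‖ < 1) : qPochhammerInf q q ≠ 0 :=
  qPochhammerInf_ne_zero hq fun k hk =>
    one_sub_pow_ne_zero hq k.succ_ne_zero (by rw [Nat.succ_eq_add_one, pow_succ', hk, sub_self])

theorem tendsto_qPochhammerInf_mul_pow {a : ℂ} (hq : ‖q‖ < 1) (h : ∀ k : ℕ, a * q ^ k ≠ 1) :
    Tendsto (fun n : ℕ => qPochhammerInf (a * q ^ n) q) atTop (𝓝 1) := by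
  have h0 := qPochhammerInf_ne_zero hq h
  have ht := (tendsto_const_nhds (x := qPochhammerInf a q)).div
    (tendsto_prod_qPochhammerInf a hq) h0
  rw [div_self h0] at ht
  refine ht.congr fun n => ?_
  have hn : ∏ i ∈ range n, (1 - a * q ^ i) ≠ 0 :=
    prod_ne_zero_iff.mpr fun i _ => sub_ne_zero.mpr (h i).symm
  simp only [Pi.div_apply]
  rw [div_eq_iff hn, mul_comm, prod_mul_qPochhammerInf a hq]

theorem tendsto_recipQFactorial (hq : ‖q‖ < 1) :
    Tendsto (fun n : ℕ => recipQFactorial q n) atTop (𝓝 (qPochhammerInf q q)⁻¹) :=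
  (tendsto_prod_qPochhammerInf q hq).inv₀ (qPochhammerInf_self_ne_zero hq)

theorem tendsto_recipQFactorial_add (hq : ‖q‖ < 1) (r : ℤ) :
    Tendsto (fun n : ℕ => recipQFactorial q (n + r)) atTop (𝓝 (qPochhammerInf q q)⁻¹) := by
  have ht : Tendsto (fun n : ℕ => ((n : ℤ) + r).toNat) atTop atTop :=
    tendsto_atTop_atTop.mpr fun b => ⟨b + r.natAbs, fun n hn => by omega⟩
  refine ((tendsto_recipQFactorial hq).comp ht).congr' ?_
  filter_upwards [eventually_ge_atTop r.natAbs] with n hn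
  simp only [Function.comp_apply]
  rw [Int.toNat_of_nonneg (by omega)]

theorem exists_norm_le_of_tendsto {u : ℕ → ℂ} {x : ℂ} (hu : Tendsto u atTop (𝓝 x)) :
    ∃ C : ℝ, ∀ n, ‖u n‖ ≤ C := by
  obtain ⟨C, hC⟩ := (Metric.isBounded_range_of_tendsto u hu).exists_norm_le
  exact ⟨C, fun n => hC _ ⟨n, rfl⟩⟩

theorem exists_norm_recipQFactorial_le (hq : ‖q‖ < 1) :
    ∃ C : ℝ, ∀ k : ℤ, ‖recipQFactorial q k‖ ≤ C := by
  obtain ⟨C, hC⟩ := exists_norm_le_of_tendsto (tendsto_recipQFactorial hq)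
  refine ⟨C, fun k => ?_⟩
  rcases lt_or_ge k 0 with hk | hk
  · rw [recipQFactorial_of_neg q hk, norm_zero]
    exact (norm_nonneg _).trans (hC 0)
  · lift k to ℕ using hk
    exact hC k

/-! ### The conjugate Bailey pair -/

/-- The factor `1 / (z q ^ n, z⁻¹ q ^ n; q)_∞` of the `n`-th summand of `ST(z, q)`. -/
noncomputable def recipTail (z q : ℂ) (n : ℕ) : ℂ :=
  (qPochhammerInf (z * q ^ n) q * qPochhammerInf (z⁻¹ * q ^ n) q)⁻¹

variable {z : ℂ}

theorem mul_recipTail (hq : ‖q‖ < 1) (hz : ∀ k : ℕ, 1 ≤ k → z * q ^ k ≠ 1 ∧ z⁻¹ * q ^ k ≠ 1)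
    {n : ℕ} (hn : 1 ≤ n) :
    (1 - z * q ^ n) * (1 - z⁻¹ * q ^ n) * recipTail z q n = recipTail z q (n + 1) := by
  unfold recipTail
  rw [← one_sub_mul_qPochhammerInf (z * q ^ n) hq, ← one_sub_mul_qPochhammerInf (z⁻¹ * q ^ n) hq,
    pow_succ, ← mul_assoc z, ← mul_assoc z⁻¹]
  have h1 : 1 - z * q ^ n ≠ 0 := sub_ne_zero.mpr (hz n hn).1.symm
  have h2 : 1 - z⁻¹ * q ^ n ≠ 0 := sub_ne_zero.mpr (hz n hn).2.symm
  rw [mul_mul_mul_comm (1 - z * q ^ n), mul_inv _ (_ * _), ← mul_assoc,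
    mul_inv_cancel₀ (mul_ne_zero h1 h2), one_mul]

theorem tendsto_recipTail_succ (hq : ‖q‖ < 1)
    (hz : ∀ k : ℕ, 1 ≤ k → z * q ^ k ≠ 1 ∧ z⁻¹ * q ^ k ≠ 1) :
    Tendsto (fun n : ℕ => recipTail z q (n + 1)) atTop (𝓝 1) := by
  have h (w : ℂ) (hw : ∀ k : ℕ, 1 ≤ k → w * q ^ k ≠ 1) :
      Tendsto (fun n : ℕ => qPochhammerInf (w * q ^ (n + 1)) q) atTop (𝓝 1) := by
    refine (tendsto_qPochhammerInf_mul_pow (a := w * q) hq fun k => ?_).congr fun n => ?_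
    · rw [mul_assoc, ← pow_succ']
      exact hw _ (by omega)
    · rw [mul_assoc, ← pow_succ']
  simpa [recipTail] using
    ((h z fun k hk => (hz k hk).1).mul (h z⁻¹ fun k hk => (hz k hk).2)).inv₀ (by simp)

/-- The condition on `z` is invariant under `z ↦ z⁻¹`, so it extends to negative exponents. -/
theorem one_sub_mul_zpow_ne_zero (hz : ∀ k : ℕ, 1 ≤ k → z * q ^ k ≠ 1 ∧ z⁻¹ * q ^ k ≠ 1)
    {r : ℤ} (hr : r ≠ 0) : 1 - z * q ^ r ≠ 0 ∧ 1 - z⁻¹ * q ^ r ≠ 0 := by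
  have key (w : ℂ) (h1 : ∀ k : ℕ, 1 ≤ k → w * q ^ k ≠ 1) (h2 : ∀ k : ℕ, 1 ≤ k → w⁻¹ * q ^ k ≠ 1) :
      1 - w * q ^ r ≠ 0 := by
    refine sub_ne_zero.mpr fun h => ?_
    rcases lt_or_gt_of_ne hr with hr | hr
    · obtain ⟨k, rfl⟩ : ∃ k : ℕ, r = -k := ⟨r.natAbs, by omega⟩
      refine h2 k (by omega) ?_
      rw [zpow_neg, zpow_natCast] at h
      rw [← inv_inv (q ^ k), ← mul_inv, ← h, inv_one]
    · lift r to ℕ using hr.le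
      exact h1 r (by omega) (by rw [h, zpow_natCast])
  exact ⟨key z (fun k hk => (hz k hk).1) fun k hk => (hz k hk).2,
    key z⁻¹ (fun k hk => (hz k hk).2) fun k hk => by rw [inv_inv]; exact (hz k hk).1⟩

/-- The summand of the conjugate Bailey pair is a difference, because
`(1 - z q^n) (1 - z⁻¹ q^n) - (1 - q^(n+r)) (1 - q^(n-r)) = q^(n-r) (1 - z q^r) (1 - z⁻¹ q^r)`. -/
theorem conjugate_summand_eq_sub (hq0 : q ≠ 0) (hq : ‖q‖ < 1) (hz0 : z ≠ 0)
    (hz : ∀ k : ℕ, 1 ≤ k → z * q ^ k ≠ 1 ∧ z⁻¹ * q ^ k ≠ 1) {r : ℤ} (hr : r ≠ 0) (n : ℕ) :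
    q ^ (n + 1) * recipTail z q (n + 1) *
        (recipQFactorial q ((n + 1 : ℕ) + r) * recipQFactorial q ((n + 1 : ℕ) - r)) =
      q ^ r / ((1 - z * q ^ r) * (1 - z⁻¹ * q ^ r)) *
          (recipQFactorial q ((n + 1 : ℕ) + r) * recipQFactorial q ((n + 1 : ℕ) - r) *
            recipTail z q (n + 1 + 1)) -
        q ^ r / ((1 - z * q ^ r) * (1 - z⁻¹ * q ^ r)) *
          (recipQFactorial q (n + r) * recipQFactorial q (n - r) * recipTail z q (n + 1)) := by
  obtain ⟨h1, h2⟩ := one_sub_mul_zpow_ne_zero hz hr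
  have e1 : (n : ℤ) + r = ((n + 1 : ℕ) + r) - 1 := by push_cast; ring
  have e2 : (n : ℤ) - r = ((n + 1 : ℕ) - r) - 1 := by push_cast; ring
  rw [e1, e2, ← one_sub_mul_recipQFactorial hq, ← one_sub_mul_recipQFactorial hq,
    ← mul_recipTail hq hz (Nat.le_add_left 1 n), ← mul_sub, div_mul_eq_mul_div,
    eq_div_iff (mul_ne_zero h1 h2), zpow_add₀ hq0, zpow_sub₀ hq0, zpow_natCast]
  have hr0 : q ^ r ≠ 0 := zpow_ne_zero r hq0
  field_simp
  ring

/-- A nonterminating sum that telescopes; it is the `q`-Gauss sum for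
`₂φ₁(z q^r, z⁻¹ q^r; q^(2r+1); q, q)`, up to its prefactor. -/
theorem hasSum_conjugate (hq0 : q ≠ 0) (hq : ‖q‖ < 1) (hz0 : z ≠ 0)
    (hz : ∀ k : ℕ, 1 ≤ k → z * q ^ k ≠ 1 ∧ z⁻¹ * q ^ k ≠ 1) {r : ℤ} (hr : r ≠ 0)
    (hs : Summable fun n : ℕ => q ^ (n + 1) * recipTail z q (n + 1) *
        (recipQFactorial q ((n + 1 : ℕ) + r) * recipQFactorial q ((n + 1 : ℕ) - r))) :
    HasSum (fun n : ℕ => q ^ (n + 1) * recipTail z q (n + 1) *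
        (recipQFactorial q ((n + 1 : ℕ) + r) * recipQFactorial q ((n + 1 : ℕ) - r)))
      (q ^ r / ((1 - z * q ^ r) * (1 - z⁻¹ * q ^ r)) *
        ((qPochhammerInf q q)⁻¹ * (qPochhammerInf q q)⁻¹)) := by
  rw [hs.hasSum_iff_tendsto_nat]
  have ht := (((tendsto_recipQFactorial_add hq r).mul (tendsto_recipQFactorial_add hq (-r))).mul
    (tendsto_recipTail_succ hq hz)).const_mul (q ^ r / ((1 - z * q ^ r) * (1 - z⁻¹ * q ^ r)))
  rw [mul_one] at ht
  refine ht.congr fun n => ?_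
  simp only [conjugate_summand_eq_sub hq0 hq hz0 hz hr]
  rw [sum_range_sub (fun n : ℕ => q ^ r / ((1 - z * q ^ r) * (1 - z⁻¹ * q ^ r)) *
    (recipQFactorial q (n + r) * recipQFactorial q (n - r) * recipTail z q (n + 1)))]
  -- The lower boundary term vanishes, as one of `r`, `-r` is negative.
  have h0 : recipQFactorial q ((0 : ℕ) + r) * recipQFactorial q ((0 : ℕ) - r) = 0 := by
    rcases lt_or_gt_of_ne hr with hr | hr
    · rw [recipQFactorial_of_neg q (k := (0 : ℕ) + r) (by simpa using hr), zero_mul]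
    · rw [recipQFactorial_of_neg q (k := (0 : ℕ) - r) (by simpa using hr), mul_zero]
  rw [h0, zero_mul, mul_zero, sub_zero]
  simp only [sub_eq_add_neg]

/-! ### Interchange of summations -/

/-- The weight at `2r` is at most `|p| ^ ((2r-1) (2r-2))`, and the quadratic exponent is at least
`|r| - 1`. -/
theorem summable_baileyWeight (hp0 : p ≠ 0) (hp : ‖p‖ < 1) :
    Summable fun r : ℤ => ‖baileyWeight p (2 * r)‖ := by
  have hg : Summable fun r : ℤ => ‖p‖⁻¹ * ‖p‖ ^ r.natAbs := by
    refine Summable.mul_left _ (summable_int_iff_summable_nat_and_neg.mpr ⟨?_, ?_⟩) <;>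
      simpa using summable_geometric_of_lt_one (norm_nonneg p) hp
  refine hg.of_nonneg_of_le (fun r => norm_nonneg _) fun r => ?_
  have hpos : 0 < ‖p‖ := norm_pos_iff.mpr hp0
  have hexp : -1 + (r.natAbs : ℤ) ≤ (2 * r - 1) * (2 * r - 2) := by
    rcases Int.natAbs_eq r with h | h <;> nlinarith [sq_nonneg (r - 1), Int.natCast_nonneg r.natAbs]
  calc ‖baileyWeight p (2 * r)‖ ≤ 1 * ‖p‖ ^ ((2 * r - 1) * (2 * r - 2)) := by
        rw [baileyWeight, norm_mul, norm_neg, norm_zpow]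
        exact mul_le_mul_of_nonneg_right (norm_charThree_le _) (zpow_nonneg hpos.le _)
    _ ≤ ‖p‖ ^ (-1 + (r.natAbs : ℤ)) := by
        rw [one_mul]
        exact zpow_le_zpow_right_of_le_one₀ hpos hp.le hexp
    _ = ‖p‖⁻¹ * ‖p‖ ^ r.natAbs := by
        rw [zpow_add₀ hpos.ne', zpow_neg_one, zpow_natCast]

/-- Reciprocal `q`-factorials and tails are bounded, so the double series is dominated by the
product of the series of `|q| ^ n` and of the weights. -/
theorem summable_double (hp0 : p ≠ 0) (hp : ‖p‖ < 1) (hq : ‖q‖ < 1)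
    (hz : ∀ k : ℕ, 1 ≤ k → z * q ^ k ≠ 1 ∧ z⁻¹ * q ^ k ≠ 1) :
    Summable fun x : ℕ × ℤ => baileyWeight p (2 * x.2) *
      (q ^ (x.1 + 1) * recipTail z q (x.1 + 1) *
        (recipQFactorial q ((x.1 + 1 : ℕ) + x.2) * recipQFactorial q ((x.1 + 1 : ℕ) - x.2))) := by
  obtain ⟨C, hC⟩ := exists_norm_recipQFactorial_le hq
  obtain ⟨D, hD⟩ := exists_norm_le_of_tendsto (tendsto_recipTail_succ hq hz)
  have hC0 : 0 ≤ C := (norm_nonneg _).trans (hC 0)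
  have hD0 : 0 ≤ D := (norm_nonneg _).trans (hD 0)
  have hg : Summable fun n : ℕ => ‖q‖ ^ (n + 1) * D * (C * C) :=
    (((summable_nat_add_iff 1).mpr (summable_geometric_of_lt_one (norm_nonneg q) hq)).mul_right
      D).mul_right (C * C)
  refine Summable.of_norm_bounded (hg.mul_of_nonneg (summable_baileyWeight hp0 hp)
    (fun n => by positivity) (fun r => norm_nonneg _)) fun x => ?_
  rw [norm_mul, norm_mul, norm_mul, norm_mul, norm_pow, mul_comm]
  gcongr
  exacts [hD _, hC _, hC _]

/-- In `ST(z, q)` the numerator `(q^(2n); q)_∞` is `(q; q)_∞ / (q; q)_{2n-1}`. -/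
theorem STTerm_eq (hq : ‖q‖ < 1) {n : ℕ} (hn : n ≠ 0) :
    STTerm z q n = qPochhammerInf q q * (q ^ n * recipTail z q n *
      recipQFactorial q (2 * n - 1 : ℤ)) := by
  obtain ⟨m, rfl⟩ := Nat.exists_eq_succ_of_ne_zero hn
  have hR : recipQFactorial q (2 * (m.succ : ℕ) - 1 : ℤ) =
      (∏ i ∈ range (2 * m + 1), (1 - q * q ^ i))⁻¹ := by
    rw [← recipQFactorial_natCast]
    congr 1
    push_cast
    ring
  have hne : ∏ i ∈ range (2 * m + 1), (1 - q * q ^ i) ≠ 0 :=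
    prod_ne_zero_iff.mpr fun i _ => by
      rw [← pow_succ']
      exact one_sub_pow_ne_zero hq (Nat.add_one_ne_zero i)
  rw [hR, ← prod_mul_qPochhammerInf q hq (2 * m + 1), ← pow_succ',
    (by omega : 2 * m + 1 + 1 = 2 * m.succ), STTerm, recipTail]
  field_simp

/-! ### The two residue classes -/

/-- Only `r = ±(3n + 1)` contribute to a sum against a weight supported off the multiples
of `3`. -/
theorem hasSum_three_mul_add_one {f : ℤ → ℂ} (hf : Summable f) (h0 : ∀ r, r % 3 = 0 → f r = 0) :
    HasSum (fun n : ℤ => f (3 * n + 1) + f (-(3 * n + 1))) (∑' r, f r) := by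
  have hi : Function.Injective fun n : ℤ => 3 * n + 1 := fun a b h => by
    simp only at h
    omega
  have hi' : Function.Injective fun n : ℤ => -(3 * n + 1) := fun a b h => by
    simp only at h
    omega
  have hinj : Function.Injective (Sum.elim (fun n : ℤ => 3 * n + 1) fun n : ℤ => -(3 * n + 1)) :=
    hi.sumElim hi' fun a b => by omega
  have hsupp : ∀ r ∉ Set.range (Sum.elim (fun n : ℤ => 3 * n + 1) fun n : ℤ => -(3 * n + 1)),
      f r = 0 := by
    intro r hr
    refine h0 r ?_
    by_contra h
    rcases (by omega : r % 3 = 1 ∨ r % 3 = 2) with h | h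
    · exact hr ⟨.inl (r / 3), by simp only [Sum.elim_inl]; omega⟩
    · exact hr ⟨.inr (-r / 3), by simp only [Sum.elim_inr]; omega⟩
  have h1 := (hf.comp_injective hi).hasSum
  have h2 := (hf.comp_injective hi').hasSum
  have h3 := (hinj.hasSum_iff hsupp).mp (h1.sum (f := f ∘ Sum.elim _ _) h2)
  rw [h3.tsum_eq]
  exact h1.add h2

/-- The contributions of `r = 3n + 1` and `-r` combine to one term of the bilateral series. -/
theorem baileyWeight_mul_add_neg (hp : p ^ 6 = q) (hq0 : q ≠ 0) (hz0 : z ≠ 0)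
    (hz : ∀ k : ℕ, 1 ≤ k → z * q ^ k ≠ 1 ∧ z⁻¹ * q ^ k ≠ 1) {r n : ℤ} (hr : r = 3 * n + 1) :
    baileyWeight p (2 * r) * (q ^ r / ((1 - z * q ^ r) * (1 - z⁻¹ * q ^ r))) +
      baileyWeight p (2 * -r) * (q ^ (-r) / ((1 - z * q ^ (-r)) * (1 - z⁻¹ * q ^ (-r)))) =
    STBilateralTerm z q n := by
  have hpq (k : ℤ) : p ^ (6 * k) = q ^ k := by
    rw [zpow_mul, ← hp]
    norm_cast
  have w1 : baileyWeight p (2 * r) = q ^ (6 * n ^ 2 + n) := by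
    rw [baileyWeight, (by unfold charThree; simp [(by omega : 2 * r % 3 = 2)] :
      charThree (2 * r) = -1), ← hpq, neg_neg, one_mul, hr]
    congr 1
    ring
  have w2 : baileyWeight p (2 * -r) = -q ^ (6 * n ^ 2 + 7 * n + 2) := by
    rw [baileyWeight, (by unfold charThree; rw [if_pos (by omega)] :
      charThree (2 * -r) = 1), ← hpq, neg_one_mul, hr]
    congr 2
    ring
  have hrne : r ≠ 0 := by omega
  obtain ⟨h1, h2⟩ := one_sub_mul_zpow_ne_zero hz hrne
  obtain ⟨h3, h4⟩ := one_sub_mul_zpow_ne_zero hz (neg_ne_zero.mpr hrne)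
  have hq' : q ^ r ≠ 0 := zpow_ne_zero r hq0
  -- The factor `q^r / ((1 - z q^r) (1 - z⁻¹ q^r))` is even in `r`.
  have heven : q ^ (-r) / ((1 - z * q ^ (-r)) * (1 - z⁻¹ * q ^ (-r))) =
      q ^ r / ((1 - z * q ^ r) * (1 - z⁻¹ * q ^ r)) := by
    rw [div_eq_div_iff (mul_ne_zero h3 h4) (mul_ne_zero h1 h2), zpow_neg]
    field_simp
    ring
  rw [heven, w1, w2, ← add_mul, STBilateralTerm, ← hr, mul_div_assoc', add_mul, neg_mul,
    ← zpow_add₀ hq0, ← zpow_add₀ hq0, mul_one_sub (q ^ (6 * n ^ 2 + 4 * n + 1)),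
    ← zpow_add₀ hq0, sub_eq_add_neg (q ^ (6 * n ^ 2 + 4 * n + 1)), hr]
  congr 3
  · ring
  · congr 1; ring

theorem mainTheorem5 (z q : ℂ) (hq0 : q ≠ 0) (hq1 : ‖q‖ < 1) (hz0 : z ≠ 0)
    (hz : ∀ k : ℕ, 1 ≤ k → z * q ^ k ≠ 1 ∧ z⁻¹ * q ^ k ≠ 1) :
    Summable (fun n : ℕ => STTerm z q (n + 1)) ∧
    Summable (fun n : ℤ => STBilateralTerm z q n) ∧
    partitionPairST z q = 1 / qPochhammerInf q q * ∑' n : ℤ, STBilateralTerm z q n := by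
  -- A sixth root of `q` turns the fractional exponents of `q` into integral ones.
  obtain ⟨p, hp⟩ := IsAlgClosed.exists_pow_nat_eq q (n := 6) (by norm_num)
  have hp0 : p ≠ 0 := by
    rintro rfl
    exact hq0 (by simp [← hp])
  have hp1 : ‖p‖ < 1 := by
    rw [← hp, norm_pow] at hq1
    exact (pow_lt_one_iff_of_nonneg (norm_nonneg p) (by norm_num)).mp hq1
  have hQ := qPochhammerInf_self_ne_zero hq1
  set Q := qPochhammerInf q q
  set F : ℕ → ℤ → ℂ := fun n r => baileyWeight p (2 * r) *
      (q ^ (n + 1) * recipTail z q (n + 1) *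
        (recipQFactorial q ((n + 1 : ℕ) + r) * recipQFactorial q ((n + 1 : ℕ) - r))) with hF
  have hFs : Summable (Function.uncurry F) := summable_double hp0 hp1 hq1 hz
  have hFs' : Summable fun x : ℤ × ℕ => F x.2 x.1 := hFs.prod_symm
  have hrow (n : ℕ) : STTerm z q (n + 1) = Q * ∑' r, F n r := by
    rw [STTerm_eq hq1 (Nat.add_one_ne_zero n),
      ← ((hasSum_baileyWeight hp hp0 hq1 (Nat.add_one_ne_zero n)).mul_left
        (q ^ (n + 1) * recipTail z q (n + 1))).tsum_eq]
    congr 1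
    exact tsum_congr fun r => mul_left_comm _ _ _
  have hcol (r : ℤ) : ∑' n, F n r = Q⁻¹ * Q⁻¹ *
      (baileyWeight p (2 * r) * (q ^ r / ((1 - z * q ^ r) * (1 - z⁻¹ * q ^ r)))) := by
    by_cases hw : baileyWeight p (2 * r) = 0
    · simp [hF, hw]
    · -- The telescoping sum needs `r ≠ 0`, which holds as the weight vanishes at `0`.
      have hr : r ≠ 0 := by
        rintro rfl
        exact hw (by simp [baileyWeight, charThree])
      have hs := (summable_mul_left_iff hw).mp (hFs'.prod_factor r)
      rw [((hasSum_conjugate hq0 hq1 hz0 hz hr hs).mul_left _).tsum_eq]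
      ring
  have hQQ : Q⁻¹ * Q⁻¹ ≠ 0 := mul_ne_zero (inv_ne_zero hQ) (inv_ne_zero hQ)
  have hS : Summable fun r : ℤ =>
      baileyWeight p (2 * r) * (q ^ r / ((1 - z * q ^ r) * (1 - z⁻¹ * q ^ r))) := by
    have h := hFs'.prod
    simp only [hcol] at h
    exact (summable_mul_left_iff hQQ).mp h
  have hB := hasSum_three_mul_add_one hS fun r hr => by
    rw [baileyWeight, charThree, if_neg (by omega), if_neg (by omega), neg_zero, zero_mul, zero_mul]
  simp only [baileyWeight_mul_add_neg hp hq0 hz0 hz rfl] at hB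
  refine ⟨?_, hB.summable, ?_⟩
  · simp only [hrow]
    exact hFs.prod.mul_left Q
  · rw [partitionPairST, hB.tsum_eq]
    simp only [hrow]
    rw [tsum_mul_left, ← hFs.tsum_comm]
    simp only [hcol]
    rw [tsum_mul_left, ← mul_assoc, mul_inv_cancel_left₀ hQ, one_div]
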